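/- Let $X$ be a collectionwise normal space, that is, a $T_1$-space such that for every discrete collection $\mathscr{D}$ of closed subsets of $X$ there is a discrete family $\{U_D : D\in\mathscr{D}\}$ of open subsets of $X$ with $D\subset U_D$ for every $D\in\mathscr{D}$ (an indexed family of subsets is discrete if every point of $X$ has a neighbourhood that meets the members for at most one index). Let $E$ be a Banach space with the metric $d$ generated by its norm, and let $\mathscr{C}'(E)$ consist of all nonempty compact subsets of $E$ together with the set $E$ itself. Let $\varphi : X\to\mathscr{C}'(E)$ be a mapping such that every $\varphi(x)$ is convex and which is lower semi-continuous, i.e. $\{x\in X : \varphi(x)\cap U\neq\emptyset\}$ is open in $X$ for every open $U\subset E$. Let $\varepsilon>0$ and let $g : X\to E$ be a continuous $\varepsilon$-selection for $\varphi$, i.e. a continuous map with $d(g(x),\varphi(x))<\varepsilon$ for every $x\in X$. Then there is a continuous map $f : X\to E$ such that $f(x)\in\varphi(x)$ and $d(f(x),g(x))\le\varepsilon$ for every $x\in X$. -/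

import Mathlib

open Topology

/-- An indexed family of subsets of `X` is discrete if every point of `X` has a neighbourhood which
meets at most one member of the family (members being counted with their indices). -/
def DiscreteFamily {ι X : Type*} [TopologicalSpace X] (F : ι → Set X) : Prop :=
  ∀ x : X, ∃ N ∈ 𝓝 x, {i | (F i ∩ N).Nonempty}.Subsingleton

/-- A space is collectionwise normal if it is `T₁` and every discrete collection `𝒟` of closed
subsets can be expanded to a discrete family `{U D : D ∈ 𝒟}` of open sets with `D ⊆ U D`. -/
class CollectionwiseNormalSpace (X : Type*) [TopologicalSpace X] : Prop extends T1Space X where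
  exists_open_expansion : ∀ 𝒟 : Set (Set X), (∀ D ∈ 𝒟, IsClosed D) →
    DiscreteFamily (fun D : 𝒟 => (D : Set X)) →
    ∃ U : 𝒟 → Set X, (∀ D, IsOpen (U D)) ∧ (∀ D : 𝒟, (D : Set X) ⊆ U D) ∧ DiscreteFamily U

/-- The family `𝒞(E)` of all nonempty compact closed subsets of `E`. -/
def compactMembers (E : Type*) [TopologicalSpace E] : Set (Set E) :=
  {S | S.Nonempty ∧ IsClosed S ∧ IsCompact S}

/-- The family `𝒞'(E) = 𝒞(E) ∪ {E}`. -/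
def compactMembers' (E : Type*) [TopologicalSpace E] : Set (Set E) :=
  compactMembers E ∪ {Set.univ}

/-- A set-valued mapping is lower semi-continuous if `{x | φ x ∩ U ≠ ∅}` is open for every
open `U`. -/
def IsLSC {X E : Type*} [TopologicalSpace X] [TopologicalSpace E] (φ : X → Set E) : Prop :=
  ∀ U : Set E, IsOpen U → IsOpen {x | (φ x ∩ U).Nonempty}

/-- `f` is a selection for `φ`. -/
def IsSelection {X E : Type*} (f : X → E) (φ : X → Set E) : Prop :=
  ∀ x, f x ∈ φ x

/-- `f` is an `ε`-selection for the nonempty-valued mapping `φ`: `d(f(x), φ(x)) < ε` for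
every `x`. -/
def IsEpsSelection {X E : Type*} [PseudoMetricSpace E] (ε : ℝ) (f : X → E) (φ : X → Set E) : Prop :=
  ∀ x, Metric.infDist (f x) (φ x) < ε

/-!
By translation it suffices to find a selection of the closure of
`ψ x = {v | g x + v ∈ φ x} ∩ ball 0 ε`, whose values are subsets of the complete convex set
`Y = closedBall 0 ε`, each relatively compact or dense in `Y`. Such a selection is the limit of
approximate selections `f n : X → Y`, where `f (n + 1)` approximates the mapping
`x ↦ ψ x ∩ ball (f n x) (2⁻¹ ^ n)`. For the inductive step, pull a locally finite cover of `Y` by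
small open sets back to `X` along the mapping. On the closed set of points at which `f n` is not
already a good approximation the values are relatively compact, so there the pulled-back cover is
point-finite, and collectionwise normality gives it a locally finite refinement and a partition
of unity.
-/

open Set Metric Filter

section CollectionwiseNormal

variable {X ι κ : Type*} [TopologicalSpace X]

theorem DiscreteFamily.eq_of_mem {F : ι → Set X} (hF : DiscreteFamily F) {i j : ι} {x : X}
    (hi : x ∈ F i) (hj : x ∈ F j) : i = j :=
  let ⟨_, hN, hs⟩ := hF x
  hs ⟨x, hi, mem_of_mem_nhds hN⟩ ⟨x, hj, mem_of_mem_nhds hN⟩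

theorem CollectionwiseNormalSpace.exists_discreteFamily_isOpen_superset
    [CollectionwiseNormalSpace X] {K : ι → Set X} (hK : ∀ i, IsClosed (K i))
    (hd : DiscreteFamily K) :
    ∃ U : ι → Set X, (∀ i, IsOpen (U i)) ∧ (∀ i, K i ⊆ U i) ∧ DiscreteFamily U := by
  obtain ⟨U, hUo, hKU, hUd⟩ := exists_open_expansion (range K) (forall_mem_range.2 hK) fun x => by
    obtain ⟨N, hN, hs⟩ := hd x
    refine ⟨N, hN, ?_⟩
    rintro ⟨_, i, rfl⟩ hi ⟨_, j, rfl⟩ hj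
    exact Subtype.ext (congrArg K (hs hi hj))
  -- Indices with `K i = ∅` share one member of the expansion, which has to be removed.
  refine ⟨fun i => {x | (K i).Nonempty ∧ x ∈ U ⟨K i, i, rfl⟩}, fun i => isOpen_const.and (hUo _),
    fun i x hx => ⟨⟨x, hx⟩, hKU ⟨K i, i, rfl⟩ hx⟩, fun x => ?_⟩
  obtain ⟨N, hN, hs⟩ := hUd x
  refine ⟨N, hN, ?_⟩
  rintro i ⟨y, ⟨⟨z, hz⟩, hyi⟩, hyN⟩ j ⟨y', ⟨-, hyj⟩, hyN'⟩
  have hKij : K i = K j := congrArg Subtype.val (hs ⟨y, hyi, hyN⟩ ⟨y', hyj, hyN'⟩)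
  exact hd.eq_of_mem hz (hKij ▸ hz)

theorem CollectionwiseNormalSpace.exists_discreteFamily_of_eventually_eq
    [CollectionwiseNormalSpace X] {K : Set X} (hK : IsClosed K) {T : X → κ}
    (hT : ∀ x ∈ K, ∀ᶠ y in 𝓝[K] x, T y = T x) :
    ∃ U : κ → Set X, (∀ k, IsOpen (U k)) ∧ (∀ x ∈ K, x ∈ U (T x)) ∧ DiscreteFamily U := by
  have hlocal (x : X) : ∃ N ∈ 𝓝 x, ∀ y ∈ N, y ∈ K → x ∈ K ∧ T y = T x := by
    by_cases hx : x ∈ K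
    · exact ⟨_, eventually_nhdsWithin_iff.1 (hT x hx), fun y hy hyK => ⟨hx, hy hyK⟩⟩
    · exact ⟨Kᶜ, hK.isOpen_compl.mem_nhds hx, fun y hy hyK => absurd hyK hy⟩
  have hclosed (k : κ) : IsClosed {x ∈ K | T x = k} := by
    refine isClosed_iff_frequently.2 fun x hx => ?_
    obtain ⟨N, hN, hNT⟩ := hlocal x
    obtain ⟨y, ⟨hyK, hyT⟩, hyN⟩ := (hx.and_eventually hN).exists
    obtain ⟨hxK, hyx⟩ := hNT y hyN hyK
    exact ⟨hxK, hyx ▸ hyT⟩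
  have hdiscrete : DiscreteFamily fun k => {x ∈ K | T x = k} := by
    intro x
    obtain ⟨N, hN, hNT⟩ := hlocal x
    refine ⟨N, hN, ?_⟩
    rintro _ ⟨y, ⟨hyK, rfl⟩, hyN⟩ _ ⟨z, ⟨hzK, rfl⟩, hzN⟩
    exact (hNT y hyN hyK).2.trans (hNT z hzN hzK).2.symm
  obtain ⟨U, hUo, hKU, hUd⟩ := exists_discreteFamily_isOpen_superset hclosed hdiscrete
  exact ⟨U, hUo, fun x hx => hKU (T x) ⟨hx, rfl⟩, hUd⟩

instance CollectionwiseNormalSpace.toNormalSpace [CollectionwiseNormalSpace X] :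
    NormalSpace X where
  normal s t hs ht hst := by
    have hlocal : ∀ x ∈ s ∪ t, ∀ᶠ y in 𝓝[s ∪ t] x, (y ∈ s) = (x ∈ s) := by
      rintro x (hx | hx)
      · filter_upwards [self_mem_nhdsWithin,
          nhdsWithin_le_nhds (ht.isOpen_compl.mem_nhds (hst.notMem_of_mem_left hx))] with y hy hyt
        exact propext (iff_of_true (hy.resolve_right hyt) hx)
      · have hxs := hst.notMem_of_mem_right hx
        filter_upwards [nhdsWithin_le_nhds (hs.isOpen_compl.mem_nhds hxs)] with y hys
        exact propext (iff_of_false hys hxs)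
    obtain ⟨U, hUo, hTU, hUd⟩ := exists_discreteFamily_of_eventually_eq (hs.union ht) hlocal
    refine ⟨U True, U False, hUo _, hUo _, fun x hx => ?_, fun x hx => ?_,
      disjoint_left.2 fun x hxT hxF => true_ne_false (hUd.eq_of_mem hxT hxF)⟩
    · simpa only [hx] using hTU x (.inl hx)
    · simpa only [hst.notMem_of_mem_right hx] using hTU x (.inr hx)

end CollectionwiseNormal

section Refinement

variable {X ι κ : Type*} [TopologicalSpace X] {W : ι → Set X} {F : Set X}

/-- The family `W` has a locally finite open refinement that covers `F`. The refinement is precise,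
that is, indexed like `W`, and it is locally finite at all points of `X`, not only at those
of `F`. -/
def HasLocallyFiniteRefinement (W : ι → Set X) (F : Set X) : Prop :=
  ∃ V : ι → Set X, (∀ i, IsOpen (V i)) ∧ (∀ i, V i ⊆ W i) ∧ LocallyFinite V ∧ F ⊆ ⋃ i, V i

theorem locallyFinite_iUnion_inter {A : κ → ι → Set X} {H : κ → Set X}
    (hA : ∀ k, LocallyFinite (A k)) (hH : LocallyFinite H) :
    LocallyFinite fun i => ⋃ k, A k i ∩ H k := by
  intro x
  obtain ⟨N, hN, hfin⟩ := hH x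
  choose M hM hMfin using fun k => hA k x
  refine ⟨N ∩ ⋂ k ∈ {k | (H k ∩ N).Nonempty}, M k,
    inter_mem hN ((biInter_mem hfin).2 fun k _ => hM k),
    (hfin.biUnion fun k _ => hMfin k).subset ?_⟩
  rintro i ⟨y, hy, hyN, hyM⟩
  obtain ⟨k, hyA, hyH⟩ := mem_iUnion.1 hy
  have hk : (H k ∩ N).Nonempty := ⟨y, hyH, hyN⟩
  exact mem_biUnion hk ⟨y, hyA, mem_iInter₂.1 hyM k hk⟩

theorem HasLocallyFiniteRefinement.glue {C H : κ → Set X}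
    (hW : ∀ k, HasLocallyFiniteRefinement W (C k)) (hHo : ∀ k, IsOpen (H k))
    (hH : LocallyFinite H) (hF : F ⊆ ⋃ k, C k ∩ H k) : HasLocallyFiniteRefinement W F := by
  choose V hVo hVW hV hCV using hW
  refine ⟨fun i => ⋃ k, V k i ∩ H k, fun i => isOpen_iUnion fun k => (hVo k i).inter (hHo k),
    fun i => iUnion_subset fun k => inter_subset_left.trans (hVW k i),
    locallyFinite_iUnion_inter hV hH, fun x hx => ?_⟩
  obtain ⟨k, hxC, hxH⟩ := mem_iUnion.1 (hF hx)
  obtain ⟨i, hxV⟩ := mem_iUnion.1 (hCV k hxC)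
  exact mem_iUnion₂.2 ⟨i, k, hxV, hxH⟩

theorem HasLocallyFiniteRefinement.exists_isClosed_subset_interior [NormalSpace X]
    (hW : HasLocallyFiniteRefinement W F) (hF : IsClosed F) :
    ∃ C, IsClosed C ∧ F ⊆ interior C ∧ HasLocallyFiniteRefinement W C := by
  obtain ⟨V, hVo, hVW, hV, hFV⟩ := hW
  obtain ⟨P, hPo, hFP, hPV⟩ := normal_exists_closure_subset hF (isOpen_iUnion hVo) hFV
  exact ⟨closure P, isClosed_closure, hFP.trans (interior_maximal subset_closure hPo),
    V, hVo, hVW, hV, hPV⟩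

theorem exists_locallyFinite_subset_iUnion_inter [NormalSpace X] (hF : IsClosed F) {C : ℕ → Set X}
    (hC : ∀ n, IsClosed (C n)) (hFC : F ⊆ ⋃ n, interior (C n)) :
    ∃ H : ℕ → Set X, (∀ n, IsOpen (H n)) ∧ LocallyFinite H ∧ F ⊆ ⋃ n, C n ∩ H n := by
  classical
  obtain ⟨P, hPo, hFP, hPC⟩ :=
    normal_exists_closure_subset hF (isOpen_iUnion fun n => isOpen_interior) hFC
  refine ⟨fun n => P \ ⋃ k ∈ Iio n, C k,
    fun n => hPo.sdiff ((finite_Iio n).isClosed_biUnion fun k _ => hC k), fun x => ?_,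
    fun x hx => ?_⟩
  · by_cases hx : x ∈ closure P
    · obtain ⟨n, hn⟩ := mem_iUnion.1 (hPC hx)
      refine ⟨interior (C n), isOpen_interior.mem_nhds hn, (finite_Iic n).subset ?_⟩
      rintro m ⟨y, ⟨-, hy⟩, hyn⟩
      exact not_lt.1 fun hnm => hy (mem_biUnion (mem_Iio.2 hnm) (interior_subset hyn))
    · refine ⟨(closure P)ᶜ, isClosed_closure.isOpen_compl.mem_nhds hx, finite_empty.subset ?_⟩
      rintro m ⟨y, ⟨hyP, -⟩, hy⟩
      exact hy (subset_closure hyP)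
  · have hex : ∃ n, x ∈ C n := (mem_iUnion.1 (hFC hx)).imp fun n hn => interior_subset hn
    refine mem_iUnion.2 ⟨Nat.find hex, Nat.find_spec hex, hFP hx, fun hx' => ?_⟩
    obtain ⟨k, hk, hxk⟩ := mem_iUnion₂.1 hx'
    exact Nat.find_min hex hk hxk

theorem HasLocallyFiniteRefinement.of_subset_iUnion_nat [NormalSpace X] (hF : IsClosed F)
    {K : ℕ → Set X} (hK : ∀ n, IsClosed (K n)) (hFK : F ⊆ ⋃ n, K n)
    (hW : ∀ n, HasLocallyFiniteRefinement W (K n)) : HasLocallyFiniteRefinement W F := by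
  choose C hC hKC hWC using fun n => (hW n).exists_isClosed_subset_interior (hK n)
  obtain ⟨H, hHo, hH, hFH⟩ :=
    exists_locallyFinite_subset_iUnion_inter hF hC (hFK.trans (iUnion_mono hKC))
  exact .glue hWC hHo hH hFH

theorem eventually_setOf_mem_subset (hW : ∀ i, IsOpen (W i)) {x : X} {S : Set ι} (hS : S.Finite)
    (hSx : S ⊆ {i | x ∈ W i}) : ∀ᶠ y in 𝓝 x, S ⊆ {i | y ∈ W i} :=
  (hS.eventually_all).2 fun i hi => (hW i).mem_nhds (hSx hi)

theorem isClosed_setOf_encard_le (hW : ∀ i, IsOpen (W i)) (n : ℕ) :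
    IsClosed {x | {i | x ∈ W i}.encard ≤ n} := by
  refine isClosed_iff_frequently.2 fun x hx => ?_
  by_contra! hlt
  obtain ⟨S, hSx, hS⟩ := exists_subset_encard_eq (Order.add_one_le_of_lt (not_le.1 hlt))
  have hSfin : S.Finite := finite_of_encard_eq_coe (k := n + 1) (by exact_mod_cast hS)
  obtain ⟨y, hy, hSy⟩ := (hx.and_eventually (eventually_setOf_mem_subset hW hSfin hSx)).exists
  have : (n : ℕ∞) + 1 ≤ n := hS ▸ (encard_le_encard hSy).trans hy
  exact absurd this (by norm_cast; omega)

variable [CollectionwiseNormalSpace X]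

theorem HasLocallyFiniteRefinement.of_encard_eq (hF : IsClosed F) (hW : ∀ i, IsOpen (W i))
    (hFW : F ⊆ ⋃ i, W i) {n : ℕ} (hn : ∀ x ∈ F, {i | x ∈ W i}.encard = n) :
    HasLocallyFiniteRefinement W F := by
  have hfin : ∀ x ∈ F, {i | x ∈ W i}.Finite := fun x hx => finite_of_encard_eq_coe (hn x hx)
  have hlocal : ∀ x ∈ F, ∀ᶠ y in 𝓝[F] x, {i | y ∈ W i} = {i | x ∈ W i} := by
    intro x hx
    filter_upwards [self_mem_nhdsWithin,
      nhdsWithin_le_nhds (eventually_setOf_mem_subset hW (hfin x hx) subset_rfl)] with y hy hxy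
    exact ((hfin x hx).eq_of_subset_of_encard_le hxy (by rw [hn x hx, hn y hy])).symm
  obtain ⟨U, hUo, hFU, hUd⟩ :=
    CollectionwiseNormalSpace.exists_discreteFamily_of_eventually_eq hF hlocal
  refine ⟨fun i => W i ∩ ⋃ S ∈ {S : Set ι | S.Finite ∧ i ∈ S}, U S,
    fun i => (hW i).inter (isOpen_biUnion fun S _ => hUo S), fun i => inter_subset_left,
    fun x => ?_, fun x hx => ?_⟩
  · obtain ⟨N, hN, hs⟩ := hUd x
    have hfinite : {S | (U S ∩ N).Nonempty ∧ S.Finite}.Finite := hs.finite.subset fun S hS => hS.1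
    refine ⟨N, hN, (hfinite.biUnion fun S hS => hS.2).subset ?_⟩
    rintro i ⟨y, ⟨-, hy⟩, hyN⟩
    obtain ⟨S, ⟨hS, hiS⟩, hyS⟩ := mem_iUnion₂.1 hy
    exact mem_biUnion ⟨⟨y, hyS, hyN⟩, hS⟩ hiS
  · obtain ⟨i, hi⟩ := mem_iUnion.1 (hFW hx)
    exact mem_iUnion.2 ⟨i, hi, mem_biUnion ⟨hfin x hx, hi⟩ (hFU x hx)⟩

theorem HasLocallyFiniteRefinement.of_encard_le (hW : ∀ i, IsOpen (W i)) (n : ℕ) (hF : IsClosed F)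
    (hFW : F ⊆ ⋃ i, W i) (hn : ∀ x ∈ F, {i | x ∈ W i}.encard ≤ n) :
    HasLocallyFiniteRefinement W F := by
  induction n generalizing F with
  | zero => exact .of_encard_eq hF hW hFW fun x hx => le_antisymm (hn x hx) bot_le
  | succ n ih =>
    let L : Set X := F ∩ {x | {i | x ∈ W i}.encard ≤ n}
    have hL : IsClosed L := hF.inter (isClosed_setOf_encard_le hW n)
    obtain ⟨V, hVo, hVW, hV, hLV⟩ :=
      ih hL (inter_subset_left.trans hFW) fun x hx => hx.2
    have hrest : HasLocallyFiniteRefinement W (F \ ⋃ i, V i) := by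
      refine .of_encard_eq (hF.sdiff (isOpen_iUnion hVo)) hW (sdiff_subset.trans hFW) (n := n + 1)
        fun x hx => le_antisymm (hn x hx.1) ?_
      have hlt : (n : ℕ∞) < {i | x ∈ W i}.encard := not_le.1 fun hle => hx.2 (hLV ⟨hx.1, hle⟩)
      exact_mod_cast Order.add_one_le_of_lt hlt
    refine .glue (κ := Bool) (C := fun b => cond b (⋃ i, V i) (F \ ⋃ i, V i))
      (H := fun _ => univ) ?_ (fun _ => isOpen_univ) (locallyFinite_of_finite _) fun x hx => ?_
    · rintro (_ | _)
      exacts [hrest, ⟨V, hVo, hVW, hV, subset_rfl⟩]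
    · by_cases hxV : x ∈ ⋃ i, V i
      exacts [mem_iUnion.2 ⟨true, hxV, trivial⟩, mem_iUnion.2 ⟨false, ⟨hx, hxV⟩, trivial⟩]

theorem HasLocallyFiniteRefinement.of_pointFinite (hF : IsClosed F) (hW : ∀ i, IsOpen (W i))
    (hFW : F ⊆ ⋃ i, W i) (hfin : ∀ x ∈ F, {i | x ∈ W i}.Finite) :
    HasLocallyFiniteRefinement W F := by
  have hK (n : ℕ) : IsClosed (F ∩ {x | {i | x ∈ W i}.encard ≤ n}) :=
    hF.inter (isClosed_setOf_encard_le hW n)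
  refine .of_subset_iUnion_nat hF hK (fun x hx => ?_) fun n =>
    .of_encard_le hW n (hK n) (inter_subset_left.trans hFW) fun x hx => hx.2
  exact mem_iUnion.2 ⟨{i | x ∈ W i}.ncard, hx, (hfin x hx).cast_ncard_eq.ge⟩

theorem exists_continuous_mem_of_pointFinite {E : Type*} [AddCommGroup E] [Module ℝ E]
    [TopologicalSpace E] [ContinuousAdd E] [ContinuousSMul ℝ E] {Z : Set X} (hZ : IsOpen Z)
    (hW : ∀ i, IsOpen (W i)) (hcover : Zᶜ ⊆ ⋃ i, W i) (hfin : ∀ x ∈ Zᶜ, {i | x ∈ W i}.Finite)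
    {g : X → E} (hg : Continuous g) (e : ι → E) :
    ∃ f : X → E, Continuous f ∧ ∀ x (C : Set E), Convex ℝ C → (x ∈ Z → g x ∈ C) →
      (∀ i, x ∈ W i → e i ∈ C) → f x ∈ C := by
  obtain ⟨V, hVo, hVW, hV, hZV⟩ :=
    HasLocallyFiniteRefinement.of_pointFinite hZ.isClosed_compl hW hcover hfin
  obtain ⟨ρ, hρ⟩ := PartitionOfUnity.exists_isSubordinate_of_locallyFinite isClosed_univ
    (Option.elim' Z V) (Option.forall.2 ⟨hZ, hVo⟩) (hV.option_elim' Z) fun x _ => by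
      by_cases hx : x ∈ Z
      · exact mem_iUnion.2 ⟨none, hx⟩
      · obtain ⟨i, hi⟩ := mem_iUnion.1 (hZV hx)
        exact mem_iUnion.2 ⟨some i, hi⟩
  have hmem (o : Option ι) {x : X} (hx : ρ o x ≠ 0) : x ∈ Option.elim' Z V o :=
    hρ o (subset_tsupport _ hx)
  let h : Option ι → X → E := Option.elim' g fun i _ => e i
  have hh : ∀ o, Continuous (h o) := Option.forall.2 ⟨hg, fun i => continuous_const⟩
  refine ⟨fun x => ∑ᶠ o, ρ o x • h o x, ρ.continuous_finsum_smul fun o x _ => (hh o).continuousAt,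
    fun x C hC hgC heC => ρ.finsum_smul_mem_convex (mem_univ x) (Option.forall.2 ⟨?_, ?_⟩) hC⟩
  · exact fun hx => hgC (hmem none hx)
  · exact fun i hx => heC i (hVW i (hmem (some i) hx))

end Refinement

section LowerSemicontinuous

variable {X E : Type*} [TopologicalSpace X]

theorem IsLSC.isOpen_setOf_exists_mem [TopologicalSpace E] {φ : X → Set E} (hφ : IsLSC φ)
    {U : Set (X × E)} (hU : IsOpen U) : IsOpen {x | ∃ y ∈ φ x, (x, y) ∈ U} := by
  refine isOpen_iff_mem_nhds.2 ?_
  rintro x ⟨y, hy, hxy⟩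
  obtain ⟨A, B, hA, hxA, hB, hyB, hAB⟩ := mem_nhds_prod_iff'.1 (hU.mem_nhds hxy)
  filter_upwards [hA.mem_nhds hxA, (hφ B hB).mem_nhds ⟨y, hy, hyB⟩]
  rintro z hzA ⟨w, hw, hwB⟩
  exact ⟨w, hw, hAB ⟨hzA, hwB⟩⟩

theorem IsLSC.inter_ball [PseudoMetricSpace E] {φ : X → Set E} (hφ : IsLSC φ) {g : X → E}
    (hg : Continuous g) (r : ℝ) : IsLSC fun x => φ x ∩ ball (g x) r := by
  intro U hU
  have hopen : IsOpen {p : X × E | dist p.2 (g p.1) < r ∧ p.2 ∈ U} :=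
    (isOpen_lt (by fun_prop) continuous_const).and (hU.preimage continuous_snd)
  simpa only [Set.Nonempty, mem_inter_iff, mem_ball, and_assoc, mem_ofPred_eq]
    using hφ.isOpen_setOf_exists_mem hopen

theorem IsLSC.preimage_add_left [AddGroup E] [TopologicalSpace E] [IsTopologicalAddGroup E]
    {φ : X → Set E} (hφ : IsLSC φ) {g : X → E} (hg : Continuous g) :
    IsLSC fun x => (g x + ·) ⁻¹' φ x := by
  intro U hU
  have hopen : IsOpen {p : X × E | -g p.1 + p.2 ∈ U} := hU.preimage (by fun_prop)
  convert hφ.isOpen_setOf_exists_mem hopen using 1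
  ext x
  constructor
  · rintro ⟨v, hv, hvU⟩
    exact ⟨g x + v, hv, by simpa using hvU⟩
  · rintro ⟨y, hy, hyU⟩
    exact ⟨-g x + y, by simpa using hy, hyU⟩

end LowerSemicontinuous

theorem tendsto_div_two_pow (c : ℝ) : Tendsto (fun n : ℕ => c / 2 ^ n) atTop (𝓝 0) :=
  tendsto_const_nhds.div_atTop (tendsto_pow_atTop_atTop_of_one_lt one_lt_two)

theorem exists_tendstoUniformly_of_dist_le_geometric_two {α β : Type*} [PseudoMetricSpace β]
    {Y : Set β} (hY : IsComplete Y) {F : ℕ → α → β} (hFY : ∀ n x, F n x ∈ Y) {c : ℝ}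
    (hF : ∀ n x, dist (F n x) (F (n + 1) x) ≤ c / 2 / 2 ^ n) :
    ∃ f : α → β, TendstoUniformly F f atTop := by
  choose f _ hf using fun x => cauchySeq_tendsto_of_isComplete hY (fun n => hFY n x)
    (cauchySeq_of_le_geometric_two fun n => hF n x)
  refine ⟨f, tendstoUniformly_iff.2 fun η hη => ?_⟩
  filter_upwards [(tendsto_div_two_pow c).eventually_lt_const hη] with n hn x
  rw [dist_comm]
  exact (dist_le_of_le_geometric_two_of_tendsto (fun n => hF n x) (hf x) n).trans_lt hn

theorem nonempty_of_mem_compactMembers' {E : Type*} [TopologicalSpace E] [Nonempty E] {S : Set E}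
    (hS : S ∈ compactMembers' E) : S.Nonempty :=
  hS.elim And.left fun hS => eq_of_mem_singleton hS ▸ univ_nonempty

theorem isCompact_inter_closedBall_or_subset {E : Type*} [PseudoMetricSpace E] {S : Set E}
    (hS : S ∈ compactMembers' E) (y : E) (r : ℝ) :
    IsCompact (S ∩ closedBall y r) ∨ closedBall y r ⊆ S :=
  hS.imp (fun hS => hS.2.2.inter_right isClosed_closedBall) fun hS =>
    (subset_univ _).trans (eq_of_mem_singleton hS).ge

section Selection

variable {X E : Type*} [TopologicalSpace X] [CollectionwiseNormalSpace X] [NormedAddCommGroup E]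
  [NormedSpace ℝ E] {Y : Set E} {ψ : X → Set E}

theorem IsLSC.exists_continuous_mem_thickening (hψ : IsLSC ψ) (hY : IsClosed Y)
    (hYconv : Convex ℝ Y) (hne : ∀ x, (ψ x).Nonempty) (hconv : ∀ x, Convex ℝ (ψ x))
    (hψY : ∀ x, ψ x ⊆ Y) {f : X → E} (hf : Continuous f) (hfY : ∀ x, f x ∈ Y) {δ : ℝ} (hδ : 0 < δ)
    (hcpt : ∀ x, f x ∉ thickening δ (ψ x) → IsCompact (closure (ψ x))) :
    ∃ f' : X → E, Continuous f' ∧ ∀ x, f' x ∈ Y ∩ thickening δ (ψ x) := by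
  obtain ⟨v, hvo, hYv, hv, hvball⟩ := precise_refinement_set hY (fun e : Y => ball (e : E) δ)
    (fun _ => isOpen_ball) fun y hy => mem_iUnion.2 ⟨⟨y, hy⟩, mem_ball_self hδ⟩
  have hZ : IsOpen {x | f x ∈ thickening δ (ψ x)} := by
    simp only [mem_thickening_iff]
    exact hψ.isOpen_setOf_exists_mem (U := {p | dist (f p.1) p.2 < δ})
      (isOpen_lt (by fun_prop) continuous_const)
  obtain ⟨f', hf', hmem⟩ := exists_continuous_mem_of_pointFinite hZ (fun e => hψ (v e) (hvo e))
    (fun x _ => by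
      obtain ⟨y, hy⟩ := hne x
      obtain ⟨e, he⟩ := mem_iUnion.1 (hYv (hψY x hy))
      exact mem_iUnion.2 ⟨e, y, hy, he⟩)
    (fun x hx => (hv.finite_nonempty_inter_compact (hcpt x hx)).subset fun e ⟨y, hy, hye⟩ =>
      ⟨y, hye, subset_closure hy⟩)
    hf (fun e => (e : E))
  refine ⟨f', hf', fun x => hmem x _ (hYconv.inter ((hconv x).thickening δ))
    (fun hx => ⟨hfY x, hx⟩) ?_⟩
  rintro e ⟨y, hy, hye⟩
  exact ⟨e.2, mem_thickening_iff.2 ⟨y, hy, mem_ball'.1 (hvball e hye)⟩⟩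

theorem IsLSC.exists_continuous_mem_thickening_dist_lt (hψ : IsLSC ψ) (hY : IsClosed Y)
    (hYconv : Convex ℝ Y) (hconv : ∀ x, Convex ℝ (ψ x)) (hψY : ∀ x, ψ x ⊆ Y)
    (hval : ∀ x, IsCompact (closure (ψ x)) ∨ Y ⊆ closure (ψ x)) {f : X → E} (hf : Continuous f)
    {r δ : ℝ} (hr : 0 < r) (hfψ : ∀ x, f x ∈ Y ∩ thickening r (ψ x)) (hδ : 0 < δ) :
    ∃ f' : X → E, Continuous f' ∧ (∀ x, f' x ∈ Y ∩ thickening δ (ψ x)) ∧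
      ∀ x, dist (f x) (f' x) < r + δ := by
  obtain ⟨f', hf', hmem⟩ := (hψ.inter_ball hf r).exists_continuous_mem_thickening hY hYconv
    (fun x => by
      obtain ⟨y, hy, hxy⟩ := mem_thickening_iff.1 (hfψ x).2
      exact ⟨y, hy, mem_ball'.2 hxy⟩)
    (fun x => (hconv x).inter (convex_ball _ _)) (fun x => inter_subset_left.trans (hψY x)) hf
    (fun x => (hfψ x).1) hδ
    (fun x hx => by
      refine (hval x).elim (fun hc => hc.of_isClosed_subset isClosed_closure
        (closure_mono inter_subset_left)) fun hdense => absurd ?_ hx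
      obtain ⟨y, hy, hxy⟩ :=
        Metric.mem_closure_iff.1 (hdense (hfψ x).1) (min r δ) (lt_min hr hδ)
      rw [lt_min_iff] at hxy
      exact mem_thickening_iff.2 ⟨y, ⟨hy, mem_ball'.2 hxy.1⟩, hxy.2⟩)
  refine ⟨f', hf', fun x =>
    ⟨(hmem x).1, thickening_subset_of_subset δ inter_subset_left (hmem x).2⟩, fun x => ?_⟩
  obtain ⟨y, ⟨-, hy⟩, hxy⟩ := mem_thickening_iff.1 (hmem x).2
  rw [dist_comm] at hxy
  exact (dist_triangle (f x) y (f' x)).trans_lt (add_lt_add (mem_ball'.1 hy) hxy)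

theorem IsLSC.exists_seq_continuous_mem_thickening (hψ : IsLSC ψ) (hY : IsClosed Y)
    (hYconv : Convex ℝ Y) (hne : ∀ x, (ψ x).Nonempty) (hconv : ∀ x, Convex ℝ (ψ x))
    (hψY : ∀ x, ψ x ⊆ Y) (hval : ∀ x, IsCompact (closure (ψ x)) ∨ Y ⊆ closure (ψ x)) :
    ∃ F : ℕ → X → E, (∀ n, Continuous (F n)) ∧ (∀ n x, F n x ∈ Y ∩ thickening (1 / 2 ^ n) (ψ x)) ∧
      ∀ n x, dist (F n x) (F (n + 1) x) ≤ 4 / 2 / 2 ^ n := by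
  obtain ⟨f₀, hf₀, hf₀ψ⟩ : ∃ f : X → E, Continuous f ∧ ∀ x, f x ∈ Y ∩ thickening 1 (ψ x) := by
    cases isEmpty_or_nonempty X
    · exact ⟨fun _ => 0, continuous_const, isEmptyElim⟩
    obtain ⟨y₀, hy₀⟩ := (hne (Classical.arbitrary X)).mono (hψY _)
    exact hψ.exists_continuous_mem_thickening hY hYconv hne hconv hψY continuous_const
      (fun _ => hy₀) one_pos fun x hx => (hval x).resolve_right fun hdense =>
        hx (closure_subset_thickening one_pos _ (hdense hy₀))
  let P (n : ℕ) (f : X → E) : Prop :=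
    Continuous f ∧ ∀ x, f x ∈ Y ∩ thickening (1 / 2 ^ n) (ψ x)
  have hstep (n : ℕ) (f : {f // P n f}) :
      ∃ f' : {f // P (n + 1) f}, ∀ x, dist (f.1 x) (f'.1 x) ≤ 4 / 2 / 2 ^ n := by
    obtain ⟨f', hf', hf'ψ, hdist⟩ := hψ.exists_continuous_mem_thickening_dist_lt hY hYconv hconv hψY
      hval f.2.1 (by positivity) f.2.2 (δ := 1 / 2 ^ (n + 1)) (by positivity)
    refine ⟨⟨f', hf', hf'ψ⟩, fun x => (hdist x).le.trans ?_⟩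
    calc (1 : ℝ) / 2 ^ n + 1 / 2 ^ (n + 1) ≤ 1 / 2 ^ n + 1 / 2 ^ n := by gcongr <;> simp
      _ = 4 / 2 / 2 ^ n := by ring
  choose next hnext using hstep
  let F (n : ℕ) : {f // P n f} := Nat.rec ⟨f₀, hf₀, by simpa using hf₀ψ⟩ next n
  exact ⟨fun n => (F n).1, fun n => (F n).2.1, fun n => (F n).2.2, fun n => hnext n (F n)⟩

theorem IsLSC.exists_continuous_isSelection_closure (hψ : IsLSC ψ) (hY : IsComplete Y)
    (hYconv : Convex ℝ Y) (hne : ∀ x, (ψ x).Nonempty) (hconv : ∀ x, Convex ℝ (ψ x))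
    (hψY : ∀ x, ψ x ⊆ Y) (hval : ∀ x, IsCompact (closure (ψ x)) ∨ Y ⊆ closure (ψ x)) :
    ∃ f : X → E, Continuous f ∧ IsSelection f fun x => closure (ψ x) := by
  obtain ⟨F, hFc, hFψ, hdist⟩ :=
    hψ.exists_seq_continuous_mem_thickening hY.isClosed hYconv hne hconv hψY hval
  obtain ⟨f, hf⟩ :=
    exists_tendstoUniformly_of_dist_le_geometric_two hY (fun n x => (hFψ n x).1) hdist
  refine ⟨f, hf.continuous (Frequently.of_forall hFc), fun x => ?_⟩
  have hinfDist (n : ℕ) : infDist (F n x) (ψ x) ≤ 1 / 2 ^ n :=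
    ((mem_thickening_iff_infDist_lt (hne x)).1 (hFψ n x).2).le
  rw [mem_closure_iff_infDist_zero (hne x)]
  exact le_antisymm (le_of_tendsto_of_tendsto'
    (((continuous_infDist_pt _).tendsto _).comp (hf.tendsto_at x)) (tendsto_div_two_pow 1)
    hinfDist) infDist_nonneg

theorem IsLSC.exists_continuous_isSelection_closure_inter_ball [CompleteSpace E] {φ : X → Set E}
    (hφ : IsLSC φ) (hconv : ∀ x, Convex ℝ (φ x)) {ε : ℝ} {g : X → E} (hg : Continuous g)
    (hne : ∀ x, (φ x ∩ ball (g x) ε).Nonempty)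
    (hval : ∀ x, IsCompact (closure (φ x ∩ ball (g x) ε)) ∨
      closedBall (g x) ε ⊆ closure (φ x ∩ ball (g x) ε)) :
    ∃ f : X → E, Continuous f ∧ IsSelection f fun x => closure (φ x ∩ ball (g x) ε) := by
  have hball (x : X) (r : ℝ) : (g x + ·) ⁻¹' closedBall (g x) r = closedBall 0 r := by
    ext v; simp
  have hclosure (x : X) : closure ((g x + ·) ⁻¹' (φ x ∩ ball (g x) ε)) =
      (g x + ·) ⁻¹' closure (φ x ∩ ball (g x) ε) :=
    ((Homeomorph.addLeft (g x)).preimage_closure _).symm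
  obtain ⟨s, hs, hsel⟩ :=
    ((hφ.inter_ball hg ε).preimage_add_left hg).exists_continuous_isSelection_closure
      (isClosed_closedBall (x := 0) (ε := ε)).isComplete (convex_closedBall 0 ε)
      (fun x => (hne x).preimage (add_left_surjective (g x)))
      (fun x => ((hconv x).inter (convex_ball _ _)).translate_preimage_right _)
      (fun x => hball x ε ▸ preimage_mono (inter_subset_right.trans ball_subset_closedBall))
      (fun x => by
        rw [hclosure, ← hball x ε]
        exact (hval x).imp (Homeomorph.addLeft (g x)).isCompact_preimage.2 preimage_mono)
  exact ⟨fun x => g x + s x, hg.add hs, fun x => (hclosure x).subset (hsel x)⟩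

end Selection

theorem proposition4p2_general
    {E : Type*} [NormedAddCommGroup E] [NormedSpace ℝ E] [CompleteSpace E]
    {X : Type*} [TopologicalSpace X] [CollectionwiseNormalSpace X]
    (φ : X → Set E) (hne : ∀ x, (φ x).Nonempty) (hlsc : IsLSC φ) (hconv : ∀ x, Convex ℝ (φ x))
    (ε : ℝ) (g : X → E) (hgc : Continuous g) (hg : IsEpsSelection ε g φ)
    (hval : ∀ x, IsCompact (φ x ∩ closedBall (g x) ε) ∨ closedBall (g x) ε ⊆ φ x) :
    ∃ f : X → E, Continuous f ∧ IsSelection f φ ∧ ∀ x, dist (f x) (g x) ≤ ε := by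
  have hball (x : X) : φ x ∩ ball (g x) ε ⊆ φ x ∩ closedBall (g x) ε :=
    inter_subset_inter_right _ ball_subset_closedBall
  obtain ⟨f, hf, hsel⟩ := hlsc.exists_continuous_isSelection_closure_inter_ball hconv hgc
    (fun x => (infDist_lt_iff (hne x)).1 (hg x) |>.imp fun y hy => ⟨hy.1, mem_ball'.2 hy.2⟩)
    (fun x => (hval x).imp (fun hc => hc.closure_of_subset (hball x)) fun hsub => by
      have hε : 0 < ε := infDist_nonneg.trans_lt (hg x)
      rw [inter_eq_right.2 (ball_subset_closedBall.trans hsub), closure_ball _ hε.ne'])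
  have hclosed (x : X) : IsClosed (φ x ∩ closedBall (g x) ε) :=
    (hval x).elim IsCompact.isClosed fun hsub =>
      (inter_eq_right.2 hsub).symm ▸ isClosed_closedBall
  have hmem (x : X) : f x ∈ φ x ∩ closedBall (g x) ε :=
    closure_minimal (hball x) (hclosed x) (hsel x)
  exact ⟨f, hf, fun x => (hmem x).1, fun x => (hmem x).2⟩

theorem proposition4p2
    {E : Type*} [NormedAddCommGroup E] [NormedSpace ℝ E] [CompleteSpace E]
    {X : Type*} [TopologicalSpace X] [CollectionwiseNormalSpace X]
    (φ : X → Set E) (hφ : ∀ x, φ x ∈ compactMembers' E) (hlsc : IsLSC φ)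
    (hconv : ∀ x, Convex ℝ (φ x))
    (ε : ℝ) (hε : 0 < ε) (g : X → E) (hgc : Continuous g) (hg : IsEpsSelection ε g φ) :
    ∃ f : X → E, Continuous f ∧ IsSelection f φ ∧ ∀ x, dist (f x) (g x) ≤ ε := by
  exact proposition4p2_general φ (fun x => nonempty_of_mem_compactMembers' (hφ x)) hlsc hconv ε g
    hgc hg fun x => isCompact_inter_closedBall_or_subset (hφ x) (g x) ε
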